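/- Let $(A,\le)$ be a well-quasi-order. Let $o(A)$ (maximal order type) and $w(A)$ (width) be the ordinal ranks of the well-founded trees, ordered by inverse prefix order with the empty sequence as root, of all finite bad sequences of $A$ (sequences $x_0,\dots,x_{n-1}$ with $x_i\not\le x_j$ for all $i<j$) and of all finite antichain sequences of $A$ (pairwise incomparable entries), respectively. Here the rank of a node $s$ is $\sup\{\mathrm{rank}(t)+1 : t<s\}$, and the rank of a tree is the rank of its root. Let $\mathrm{P}_f(A)$ be the well-quasi-order of all finite subsets of $A$ with the Hoare ordering $S\sqsubseteq T \iff \forall a\in S\ \exists b\in T:\ a\le b$. Suppose that $w(A)=o(A)$. Then, with ordinal exponentiation, $o(\mathrm{P}_f(A))=2^{o(A)}$; and if moreover $o(A)$ is infinite or $o(A)=0$ (that is, unless $o(A)$ is a positive integer), then $w(\mathrm{P}_f(A))=o(\mathrm{P}_f(A))=2^{o(A)}$. -/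

import Mathlib

universe u

namespace Wqo

section Trees

variable {A : Type u}

/-- `t` lies strictly below `s` in a tree of finite sequences ordered by inverse prefix order:
`s` is a proper prefix of `t`. The empty sequence is the root. -/
def StrictlyBelow {P : List A → Prop} (t s : {l : List A // P l}) : Prop :=
  s.1 <+: t.1 ∧ s.1 ≠ t.1

/-- A finite sequence `x₀, …, xₙ₋₁` is bad if there are no `i < j` with `xᵢ ≤ xⱼ`. -/
def IsBadSeq [Preorder A] (l : List A) : Prop :=
  l.Pairwise fun x y => ¬ x ≤ y

/-- A finite sequence is an antichain sequence if its entries at distinct positions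
are incomparable. -/
def IsAntichainSeq [Preorder A] (l : List A) : Prop :=
  l.Pairwise fun x y => ¬ x ≤ y ∧ ¬ y ≤ x

theorem IsAntichainSeq.isBadSeq [Preorder A] {l : List A} (h : IsAntichainSeq l) :
    IsBadSeq l :=
  List.Pairwise.imp (fun hxy => hxy.1) h

end Trees

/-- The tree of (finite) bad sequences of `A`. -/
abbrev Bad (A : Type u) [Preorder A] : Type u := {l : List A // IsBadSeq l}

/-- The tree of (finite) antichain sequences of `A`. -/
abbrev Inco (A : Type u) [Preorder A] : Type u := {l : List A // IsAntichainSeq l}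

/-- The tree of bad sequences of a well-quasi-order has no infinite branch. -/
instance Bad.isWellFounded (A : Type u) [Preorder A] [WellQuasiOrderedLE A] :
    IsWellFounded (Bad A) StrictlyBelow where
  wf := by
    rw [wellFounded_iff_isEmpty_descending_chain]
    refine ⟨fun ⟨f, hf⟩ => ?_⟩
    have hpre : ∀ i j, i ≤ j → (f i).1 <+: (f j).1 := by
      intro i j hij
      induction hij with
      | refl => exact List.prefix_rfl
      | step _ ih => exact ih.trans (hf _).1
    have hlen : ∀ n, n ≤ (f n).1.length := by
      intro n
      induction n with
      | zero => exact Nat.zero_le _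
      | succ n ih =>
        have h1 := (hf n).1.length_le
        have h2 : (f n).1.length ≠ (f (n + 1)).1.length :=
          fun h => (hf n).2 ((hf n).1.eq_of_length h)
        omega
    let a : ℕ → A := fun n => (f (n + 1)).1[n]'(hlen (n + 1))
    obtain ⟨i, j, hij, hle⟩ := wellQuasiOrdered_le (α := A) a
    have hbad := List.pairwise_iff_getElem.1 (f (j + 1)).2 i j
      (hij.trans (hlen (j + 1))) (hlen (j + 1)) hij
    have hi : a i = (f (j + 1)).1[i]'(hij.trans (hlen (j + 1))) :=
      (hpre (i + 1) (j + 1) (by omega)).getElem _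
    rw [hi] at hle
    exact hbad hle

/-- The tree of antichain sequences of a well-quasi-order has no infinite branch. -/
instance Inco.isWellFounded (A : Type u) [Preorder A] [WellQuasiOrderedLE A] :
    IsWellFounded (Inco A) StrictlyBelow where
  wf := InvImage.wf (fun s : Inco A => (⟨s.1, s.2.isBadSeq⟩ : Bad A))
    (Bad.isWellFounded A).wf

/-- The maximal order type `o(A)`: the ordinal rank of the root (the empty sequence) of the tree
of bad sequences of `A`. -/
noncomputable def maxOrderType (A : Type u) [Preorder A] [WellQuasiOrderedLE A] : Ordinal.{u} :=
  IsWellFounded.rank StrictlyBelow (⟨[], List.Pairwise.nil⟩ : Bad A)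

/-- The width `w(A)`: the ordinal rank of the root (the empty sequence) of the tree
of antichain sequences of `A`. -/
noncomputable def width (A : Type u) [Preorder A] [WellQuasiOrderedLE A] : Ordinal.{u} :=
  IsWellFounded.rank StrictlyBelow (⟨[], List.Pairwise.nil⟩ : Inco A)

/-- The finitary powerset: the finite subsets of `A`. It is a separate type from `Finset A`
because it is ordered by the Hoare embedding, not by inclusion. -/
structure Pf (A : Type u) : Type u where
  /-- The underlying finite subset. -/
  carrier : Finset A

/-- The Hoare embedding (domination) quasi-ordering on finite subsets. -/
instance Pf.instPreorder (A : Type u) [Preorder A] : Preorder (Pf A) where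
  le S T := ∀ a ∈ S.carrier, ∃ b ∈ T.carrier, a ≤ b
  le_refl _ a ha := ⟨a, ha, le_rfl⟩
  le_trans _ _ _ hST hTU a ha :=
    let ⟨b, hb, hab⟩ := hST a ha
    let ⟨c, hc, hbc⟩ := hTU b hb
    ⟨c, hc, hab.trans hbc⟩

/-- The finitary powerset of a well-quasi-order is a well-quasi-order (from Higman's lemma). -/
instance Pf.instWellQuasiOrderedLE (A : Type u) [Preorder A] [WellQuasiOrderedLE A] :
    WellQuasiOrderedLE (Pf A) where
  wqo f := by
    have hA : (Set.univ : Set A).PartiallyWellOrderedOn (· ≤ ·) :=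
      Set.isPWO_of_wellQuasiOrderedLE _
    have h := hA.partiallyWellOrderedOn_sublistForall₂ (· ≤ ·)
    obtain ⟨m, n, hmn, hle⟩ := h.exists_lt (f := fun n => (f n).carrier.toList)
      (fun _ _ _ => Set.mem_univ _)
    refine ⟨m, n, hmn, fun a ha => ?_⟩
    obtain ⟨l, hl, hsub⟩ := List.sublistForall₂_iff.1 hle
    obtain ⟨i, hi, rfl⟩ := List.mem_iff_getElem.1 (Finset.mem_toList.2 ha)
    have hi' : i < l.length := hl.length_eq ▸ hi
    have hab := hl.get hi hi'
    exact ⟨l[i], Finset.mem_toList.1 (hsub.subset (List.getElem_mem _)), hab⟩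

end Wqo

/-! Both invariants are ranks of a game: playing `x` in `X` leaves only the elements that may follow
`x`. Three bounds, each for arbitrary subsets of `A`, give the theorem. `o(Pf) ≤ 2^o`
(`gameRank_finSubsets_le`): at a successor, a maximal element splits the finite sets into two
families of rank at most `2^β`, combined by natural sum; at a limit, what remains after one move is
a finite union of smaller families. `2^w ≤ o(Pf)` (`opow_width_le_gameRank_finSubsets`): with `x`
first in an antichain sequence, the sets `T ∪ {x}` can all be played before the sets `T`, which
doubles the rank. `2^w ≤ w(Pf)` for infinite `w` (`opow_mul_le_gameRank_prod`): `T ≤ T ∪ {x}` breaks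
the doubling, so a chain factor `k` is carried along to absorb it. The hypothesis `w = o` closes the
gaps. -/

namespace Wqo

open Ordinal Order

/-! ### Ranks of the games behind bad and antichain sequences -/

section GameRank

variable {P : Type u} {Q : Type u}

/-- The elements of `X` that may be played after `x`. -/
def residual (r : P → P → Prop) (X : Set P) (x : P) : Set P := {y ∈ X | r x y}

/-- `Y` arises from `X` by playing one element of `X`. -/
def Step (r : P → P → Prop) (Y X : Set P) : Prop := ∃ x ∈ X, Y = residual r X x

/-- `x` is not below `y`. -/
abbrev NotLE [Preorder P] (x y : P) : Prop := ¬ x ≤ y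

/-- `x` and `y` are incomparable. -/
abbrev Incomp [Preorder P] (x y : P) : Prop := ¬ x ≤ y ∧ ¬ y ≤ x

theorem wellFounded_step [Preorder P] [WellQuasiOrderedLE P] {r : P → P → Prop}
    (hr : ∀ x y, r x y → ¬ x ≤ y) : WellFounded (Step r) := by
  rw [wellFounded_iff_isEmpty_descending_chain]
  refine ⟨fun ⟨X, hX⟩ => ?_⟩
  choose x hx hX' using hX
  have hsub : ∀ i j, i ≤ j → X j ⊆ X i := by
    intro i j hij
    induction hij with
    | refl => exact subset_rfl
    | step _ ih => exact (hX' _ ▸ fun y hy => ih hy.1)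
  obtain ⟨i, j, hij, hle⟩ := wellQuasiOrdered_le (α := P) x
  have h1 : x j ∈ residual r (X i) (x i) := hX' i ▸ hsub (i + 1) j hij (hx j)
  exact hr _ _ h1.2 hle

instance [Preorder P] [WellQuasiOrderedLE P] :
    IsWellFounded (Set P) (Step (NotLE (P := P))) :=
  ⟨wellFounded_step fun _ _ h => h⟩

instance [Preorder P] [WellQuasiOrderedLE P] :
    IsWellFounded (Set P) (Step (Incomp (P := P))) :=
  ⟨wellFounded_step fun _ _ h => h.1⟩

/-- The rank of the game in which elements of `X` are played, each related by `r` to all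
later ones. -/
noncomputable def gameRank (r : P → P → Prop) [IsWellFounded (Set P) (Step r)] (X : Set P) :
    Ordinal.{u} :=
  IsWellFounded.rank (Step r) X

variable (r : P → P → Prop) [IsWellFounded (Set P) (Step r)]

theorem gameRank_residual_lt {X : Set P} {x : P} (hx : x ∈ X) :
    gameRank r (residual r X x) < gameRank r X :=
  IsWellFounded.rank_lt_of_rel ⟨x, hx, rfl⟩

theorem gameRank_le {X : Set P} {α : Ordinal.{u}}
    (h : ∀ x ∈ X, gameRank r (residual r X x) < α) : gameRank r X ≤ α := by
  rw [gameRank, IsWellFounded.rank_eq]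
  refine Ordinal.iSup_le ?_
  rintro ⟨_, x, hx, rfl⟩
  exact Order.succ_le_of_lt (h x hx)

theorem exists_le_gameRank_residual {X : Set P} {α : Ordinal.{u}} (h : α < gameRank r X) :
    ∃ x ∈ X, α ≤ gameRank r (residual r X x) := by
  by_contra! H
  exact (gameRank_le r H).not_gt h

theorem set_induction {motive : Set P → Prop}
    (h : ∀ X, (∀ x ∈ X, motive (residual r X x)) → motive X) (X : Set P) : motive X :=
  (IsWellFounded.wf (r := Step r)).induction X fun X ih => h X fun x hx => ih _ ⟨x, hx, rfl⟩

/-- Every move in `X` is copied along `f`, and `f` carries the remaining positions to legal ones. -/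
theorem gameRank_le_of_map {r' : Q → Q → Prop} [IsWellFounded (Set Q) (Step r')] (f : P → Q)
    (X : Set P) : ∀ Y : Set Q, (∀ x ∈ X, f x ∈ Y) →
      (∀ x ∈ X, ∀ x' ∈ X, r x x' → r' (f x) (f x')) → gameRank r X ≤ gameRank r' Y := by
  induction X using set_induction r with
  | h X ih =>
    intro Y hY hr
    refine gameRank_le r fun x hx => ?_
    refine (ih x hx _ (fun y hy => ?_) fun y hy y' hy' => hr y hy.1 y' hy'.1).trans_lt
      (gameRank_residual_lt r' (hY x hx))
    exact ⟨hY y hy.1, hr x hx y hy.1 hy.2⟩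

theorem gameRank_mono {X Y : Set P} (h : X ⊆ Y) : gameRank r X ≤ gameRank r Y :=
  gameRank_le_of_map r id X Y h fun _ _ _ _ h => h

theorem gameRank_empty : gameRank r ∅ = 0 :=
  nonpos_iff_eq_zero.1 <| gameRank_le r (by simp)

theorem gameRank_eq_zero_iff {X : Set P} : gameRank r X = 0 ↔ X = ∅ := by
  refine ⟨fun h => ?_, fun h => h ▸ gameRank_empty r⟩
  rw [Set.eq_empty_iff_forall_notMem]
  intro x hx
  exact (gameRank_residual_lt r hx).not_ge (h ▸ zero_le)

/-- Elements of `Z` may be played before those of `W`. -/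
theorem gameRank_add_le (W Z : Set P) (h : ∀ z ∈ Z, ∀ w ∈ W, r z w) (X : Set P)
    (hW : W ⊆ X) (hZ : Z ⊆ X) : gameRank r W + gameRank r Z ≤ gameRank r X := by
  induction Z using set_induction r generalizing X with
  | h Z ih =>
    refine le_of_forall_lt fun γ hγ => ?_
    obtain hlt | hle := lt_or_ge γ (gameRank r W)
    · exact hlt.trans_le (gameRank_mono r hW)
    -- The first move is a `z ∈ Z` leaving rank at least `γ - gameRank r W` in `Z`; all of `W` stays
    -- playable.
    · obtain ⟨z, hz, hzγ⟩ := exists_le_gameRank_residual r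
        (lt_of_add_lt_add_left ((Ordinal.add_sub_cancel_of_le hle).symm ▸ hγ :
          gameRank r W + (γ - gameRank r W) < gameRank r W + gameRank r Z))
      refine lt_of_le_of_lt ?_ (gameRank_residual_lt r (hZ hz))
      rw [← Ordinal.add_sub_cancel_of_le hle]
      refine (add_le_add_right hzγ _).trans (ih z hz (fun z' hz' => h z' hz'.1) _ ?_ ?_)
      · exact fun w hw => ⟨hW hw, h z hz w hw⟩
      · exact fun w hw => ⟨hZ hw.1, hw.2⟩

/-- The rank of a node in the tree of sequences related by `r` is the rank of the set of its
possible continuations. -/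
theorem rank_eq_gameRank [IsWellFounded {l : List P // l.Pairwise r} StrictlyBelow]
    (s : {l : List P // l.Pairwise r}) :
    IsWellFounded.rank StrictlyBelow s = gameRank r {y | ∀ x ∈ s.1, r x y} := by
  induction s using (IsWellFounded.wf
    (r := StrictlyBelow (P := fun l : List P => l.Pairwise r))).induction with
  | h s ih =>
  apply le_antisymm
  · rw [IsWellFounded.rank_eq]
    refine Ordinal.iSup_le ?_
    rintro ⟨t, ht⟩
    refine Order.succ_le_of_lt ?_
    rw [ih t ht]
    obtain ⟨⟨d, hd⟩, hne⟩ := ht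
    cases d with
    | nil => exact absurd (by simpa using hd) hne
    | cons x d =>
      have htp := t.2
      rw [← hd, List.pairwise_append] at htp
      have hx : x ∈ {y | ∀ z ∈ s.1, r z y} := fun z hz => htp.2.2 z hz x (by simp)
      refine lt_of_le_of_lt (gameRank_mono r ?_) (gameRank_residual_lt r hx)
      intro y hy
      simp only [← hd, Set.mem_ofPred_eq, List.mem_append, List.mem_cons] at hy
      exact ⟨fun z hz => hy z (Or.inl hz), hy x (by simp)⟩
  · refine gameRank_le r fun x hx => ?_
    have hp : (s.1 ++ [x]).Pairwise r := by
      rw [List.pairwise_append]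
      exact ⟨s.2, by simp, fun z hz y hy => by
        rw [List.mem_singleton] at hy; exact hy ▸ hx z hz⟩
    have hlt : StrictlyBelow (⟨s.1 ++ [x], hp⟩ : {l : List P // l.Pairwise r}) s :=
      ⟨List.prefix_append _ _, by simp⟩
    refine lt_of_le_of_lt (le_of_eq ?_) (IsWellFounded.rank_lt_of_rel hlt)
    rw [ih _ hlt]
    congr 1
    ext y
    simp only [residual, Set.mem_ofPred_eq, List.mem_append, List.mem_singleton]
    constructor
    · rintro ⟨h1, h2⟩ z (hz | rfl)
      exacts [h1 z hz, h2]
    · exact fun h => ⟨fun z hz => h z (Or.inl hz), h x (Or.inr rfl)⟩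

end GameRank

section Order

variable {P Q : Type u} [Preorder P] [WellQuasiOrderedLE P] [Preorder Q] [WellQuasiOrderedLE Q]

theorem maxOrderType_eq_gameRank : maxOrderType P = gameRank NotLE (Set.univ : Set P) := by
  have := @rank_eq_gameRank P NotLE _ (Bad.isWellFounded P) ⟨[], List.Pairwise.nil⟩
  refine Eq.trans this ?_
  congr 1
  simp

theorem width_eq_gameRank : width P = gameRank Incomp (Set.univ : Set P) := by
  have := @rank_eq_gameRank P Incomp _ (Inco.isWellFounded P) ⟨[], List.Pairwise.nil⟩
  refine Eq.trans this ?_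
  congr 1
  simp

theorem gameRank_notLE_le_of_map (f : P → Q) {X : Set P} {Y : Set Q} (hf : ∀ x ∈ X, f x ∈ Y)
    (h : ∀ x ∈ X, ∀ x' ∈ X, f x ≤ f x' → x ≤ x') : gameRank NotLE X ≤ gameRank NotLE Y :=
  gameRank_le_of_map _ f X Y hf fun x hx x' hx' hr hle => hr (h x hx x' hx' hle)

theorem gameRank_incomp_le_of_map (f : P → Q) {X : Set P} {Y : Set Q} (hf : ∀ x ∈ X, f x ∈ Y)
    (h : ∀ x ∈ X, ∀ x' ∈ X, f x ≤ f x' → x ≤ x') : gameRank Incomp X ≤ gameRank Incomp Y :=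
  gameRank_le_of_map _ f X Y hf fun x hx x' hx' hr =>
    ⟨fun hle => hr.1 (h x hx x' hx' hle), fun hle => hr.2 (h x' hx' x hx hle)⟩

theorem gameRank_incomp_le_notLE (X : Set P) : gameRank Incomp X ≤ gameRank NotLE X :=
  gameRank_le_of_map _ id X X (fun _ h => h) fun _ _ _ _ h => h.1

end Order

/-! ### Natural sums and ranks of unions -/

section NaturalSum

/-- The natural (Hessenberg) sum of ordinals. -/
noncomputable def nadd (a b : Ordinal.{u}) : Ordinal.{u} :=
  max (⨆ x : Set.Iio a, succ (nadd x.1 b)) (⨆ y : Set.Iio b, succ (nadd a y.1))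
termination_by (a, b)
decreasing_by
  · exact Prod.Lex.left _ _ x.2
  · exact Prod.Lex.right _ y.2

theorem nadd_lt_nadd_right {a a' : Ordinal.{u}} (h : a' < a) (b : Ordinal.{u}) :
    nadd a' b < nadd a b := by
  conv_rhs => rw [nadd]
  refine lt_max_of_lt_left (lt_of_lt_of_le (Order.lt_succ _) ?_)
  exact Ordinal.le_iSup (fun x : Set.Iio a => succ (nadd x.1 b)) ⟨a', h⟩

theorem nadd_lt_nadd_left (a : Ordinal.{u}) {b b' : Ordinal.{u}} (h : b' < b) :
    nadd a b' < nadd a b := by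
  conv_rhs => rw [nadd]
  refine lt_max_of_lt_right (lt_of_lt_of_le (Order.lt_succ _) ?_)
  exact Ordinal.le_iSup (fun y : Set.Iio b => succ (nadd a y.1)) ⟨b', h⟩

theorem nadd_le {a b c : Ordinal.{u}} (h1 : ∀ a' < a, nadd a' b < c)
    (h2 : ∀ b' < b, nadd a b' < c) : nadd a b ≤ c := by
  rw [nadd]
  exact max_le (Ordinal.iSup_le fun x => succ_le_of_lt (h1 _ x.2))
    (Ordinal.iSup_le fun x => succ_le_of_lt (h2 _ x.2))

theorem nadd_mono {a a' b b' : Ordinal.{u}} (ha : a' ≤ a) (hb : b' ≤ b) :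
    nadd a' b' ≤ nadd a b := by
  have h1 : nadd a' b' ≤ nadd a b' := by
    rcases ha.eq_or_lt with rfl | h
    exacts [le_rfl, (nadd_lt_nadd_right h _).le]
  refine h1.trans ?_
  rcases hb.eq_or_lt with rfl | h
  exacts [le_rfl, (nadd_lt_nadd_left _ h).le]

/-- When `θ` is closed under natural sum, coefficients of `θ` add: going below `θ * k + r` lowers
the remainder, or lowers the coefficient and frees the remainder, which stays below `θ`. -/
theorem nadd_mul_add_le {θ : Ordinal.{u}} (hθ : θ ≠ 0)
    (hcl : ∀ r < θ, ∀ s < θ, nadd r s < θ) (a b : Ordinal.{u}) :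
    ∀ (k m : ℕ) (r s : Ordinal.{u}), r < θ → s < θ → a = θ * k + r → b = θ * m + s →
      nadd a b ≤ θ * (k + m : ℕ) + nadd r s := by
  have key : ∀ (k : ℕ) (r a' : Ordinal.{u}), r < θ → a' < θ * k + r →
      (∃ r' < r, a' = θ * k + r') ∨ ∃ k' < k, ∃ r' < θ, a' = θ * (k' : ℕ) + r' := by
    intro k r a' hr ha'
    obtain hlt | hle := lt_or_ge a' (θ * k)
    · right
      obtain ⟨k', hk'⟩ := Ordinal.lt_omega0.1
        (((Ordinal.lt_mul_iff_div_lt hθ).1 hlt).trans (Ordinal.natCast_lt_omega0 k))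
      refine ⟨k', ?_, a' % θ, Ordinal.mod_lt _ hθ, ?_⟩
      · have := (Ordinal.lt_mul_iff_div_lt hθ).1 hlt
        rw [hk'] at this
        exact_mod_cast this
      · rw [← hk', Ordinal.div_add_mod]
    · left
      refine ⟨a' - θ * k, ?_, (Ordinal.add_sub_cancel_of_le hle).symm⟩
      rw [← Ordinal.add_sub_cancel_of_le hle] at ha'
      exact lt_of_add_lt_add_left ha'
  have key2 : ∀ (n n' : ℕ) (c d : Ordinal.{u}), n' < n → c < θ →
      θ * n' + c < θ * n + d := by
    intro n n' c d hn hc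
    have h1 : θ * n' + c < θ * n' + θ := by gcongr
    refine h1.trans_le ?_
    have h2 : θ * (n' : Ordinal.{u}) + θ = θ * ((n' + 1 : ℕ) : Ordinal.{u}) := by
      push_cast; rw [mul_add_one]
    rw [h2]
    have h3 : ((n' + 1 : ℕ) : Ordinal.{u}) ≤ n := by exact_mod_cast hn
    exact (mul_le_mul_right h3 θ).trans le_self_add
  induction a using WellFoundedLT.induction generalizing b with
  | ind a iha =>
  induction b using WellFoundedLT.induction with
  | ind b ihb =>
  rintro k m r s hr hs rfl rfl
  refine nadd_le (fun a' ha' => ?_) fun b' hb' => ?_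
  · obtain ⟨r', hr', h⟩ | ⟨k', hk', r', hr', h⟩ := key k r a' hr ha'
    · refine (iha a' ha' _ k m r' s (hr'.trans hr) hs h rfl).trans_lt ?_
      gcongr
      exact nadd_lt_nadd_right hr' s
    · refine (iha a' ha' _ k' m r' s hr' hs h rfl).trans_lt ?_
      exact key2 _ _ _ _ (by omega) (hcl _ hr' _ hs)
  · obtain ⟨r', hr', h⟩ | ⟨k', hk', r', hr', h⟩ := key m s b' hs hb'
    · refine (ihb b' hb' k m r r' hr (hr'.trans hs) rfl h).trans_lt ?_
      gcongr
      exact nadd_lt_nadd_left r hr'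
    · refine (ihb b' hb' k k' r r' hr hr' rfl h).trans_lt ?_
      exact key2 _ _ _ _ (by omega) (hcl _ hr _ hr')

theorem nadd_zero_zero : nadd (0 : Ordinal.{u}) 0 = 0 :=
  nonpos_iff_eq_zero.1 (nadd_le (by simp) (by simp))

theorem nadd_lt_opow_of_isSuccLimit {l : Ordinal.{u}} (hl : IsSuccLimit l)
    (ih : ∀ β < l, nadd (2 ^ β) (2 ^ β) ≤ 2 ^ (β + 1)) (r : Ordinal.{u}) (hr : r < 2 ^ l)
    (s : Ordinal.{u}) (hs : s < 2 ^ l) : nadd r s < 2 ^ l := by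
  obtain ⟨c, hc, hrc⟩ := (lt_opow_of_isSuccLimit two_ne_zero hl).1 hr
  obtain ⟨d, hd, hsd⟩ := (lt_opow_of_isSuccLimit two_ne_zero hl).1 hs
  have hmax : max c d < l := max_lt hc hd
  refine ((nadd_mono (hrc.le.trans ?_) (hsd.le.trans ?_)).trans (ih _ hmax)).trans_lt ?_
  · exact opow_le_opow_right two_pos (le_max_left _ _)
  · exact opow_le_opow_right two_pos (le_max_right _ _)
  · exact (opow_lt_opow_iff_right one_lt_two).2 (hl.succ_lt hmax)

theorem nadd_opow_mul_le (β : Ordinal.{u}) (k m : ℕ) :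
    nadd (2 ^ β * k) (2 ^ β * m) ≤ 2 ^ β * (k + m : ℕ) := by
  induction β using WellFoundedLT.induction generalizing k m with
  | ind β ih =>
  have of_closed : (∀ r < (2 : Ordinal.{u}) ^ β, ∀ s < (2 : Ordinal.{u}) ^ β,
      nadd r s < 2 ^ β) → nadd (2 ^ β * k) (2 ^ β * m) ≤ 2 ^ β * (k + m : ℕ) := by
    intro hcl
    have hpos : (0 : Ordinal.{u}) < 2 ^ β := opow_pos _ two_pos
    have := nadd_mul_add_le hpos.ne' hcl _ _ k m 0 0 hpos hpos rfl rfl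
    simpa only [nadd_zero_zero, add_zero] using this
  rcases zero_or_succ_or_isSuccLimit β with rfl | ⟨γ, rfl⟩ | hl
  · refine of_closed fun r hr s hs => ?_
    simp only [opow_zero, lt_one_iff] at hr hs ⊢
    rw [hr, hs, nadd_zero_zero]
  -- `2 ^ succ γ` is not closed under natural sum; the factor 2 moves into the coefficients, hence
  -- the general `k` and `m`.
  · have h := ih γ (Order.lt_succ γ) (2 * k) (2 * m)
    have e : ∀ n : ℕ, (2 : Ordinal.{u}) ^ succ γ * n = 2 ^ γ * (2 * n : ℕ) := by
      intro n
      rw [opow_succ, mul_assoc]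
      push_cast
      rfl
    rw [e, e, e, mul_add]
    exact h
  · refine of_closed (nadd_lt_opow_of_isSuccLimit hl fun γ hγ => ?_)
    have := ih γ hγ 1 1
    simpa [one_add_one_eq_two, opow_add] using this

theorem nadd_opow_self_le (β : Ordinal.{u}) : nadd (2 ^ β) (2 ^ β) ≤ 2 ^ (β + 1) := by
  have := nadd_opow_mul_le β 1 1
  simpa [one_add_one_eq_two, opow_add] using this

variable {P : Type u} [Preorder P] [WellQuasiOrderedLE P]

/-- Each move strictly lowers the rank of the part containing it and does not raise the other. -/
theorem gameRank_union_le (X Y : Set P) :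
    gameRank NotLE (X ∪ Y) ≤ nadd (gameRank NotLE X) (gameRank NotLE Y) := by
  generalize hU : X ∪ Y = U
  induction U using set_induction (NotLE (P := P)) generalizing X Y with
  | h U ih =>
    subst hU
    refine gameRank_le _ fun x hx => ?_
    have hres : residual NotLE X x ∪ residual NotLE Y x = residual NotLE (X ∪ Y) x := by
      ext y
      simp only [residual, Set.mem_union, Set.mem_ofPred_eq]
      tauto
    refine (ih x hx _ _ hres).trans_lt ?_
    have hX : gameRank NotLE (residual NotLE X x) ≤ gameRank NotLE X :=
      gameRank_mono _ fun y hy => hy.1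
    have hY : gameRank NotLE (residual NotLE Y x) ≤ gameRank NotLE Y :=
      gameRank_mono _ fun y hy => hy.1
    rcases hx with hx | hx
    · exact (nadd_mono le_rfl hY).trans_lt (nadd_lt_nadd_right (gameRank_residual_lt _ hx) _)
    · exact (nadd_mono hX le_rfl).trans_lt (nadd_lt_nadd_left _ (gameRank_residual_lt _ hx))

end NaturalSum

end Wqo

namespace Wqo

open Ordinal Order

/-! ### Finite subsets under the Hoare ordering -/

section Powerset

variable {A : Type u}

/-- The finite subsets of `D`. -/
def finSubsets (D : Set A) : Set (Pf A) := {T | ∀ t ∈ T.carrier, t ∈ D}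

open Classical in
/-- The finite subset `T` with `x` added. -/
noncomputable def Pf.insert (x : A) (T : Pf A) : Pf A := ⟨Insert.insert x T.carrier⟩

theorem finSubsets_mono {D E : Set A} (h : D ⊆ E) : finSubsets D ⊆ finSubsets E :=
  fun _ hT t ht => h (hT t ht)

theorem empty_mem_finSubsets (D : Set A) : (⟨∅⟩ : Pf A) ∈ finSubsets D := by
  simp [finSubsets]

theorem finSubsets_univ : finSubsets (Set.univ : Set A) = Set.univ := by
  simp [finSubsets]

theorem Pf.mem_insert {x t : A} {T : Pf A} :
    t ∈ (T.insert x).carrier ↔ t = x ∨ t ∈ T.carrier := by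
  simp [Pf.insert]

theorem Pf.insert_mem_finSubsets {D : Set A} {x : A} (hx : x ∈ D) {T : Pf A}
    (hT : T ∈ finSubsets D) : T.insert x ∈ finSubsets D := by
  intro t ht
  rcases Pf.mem_insert.1 ht with rfl | ht
  exacts [hx, hT t ht]

variable [Preorder A]

theorem Pf.le_of_le_insert {x : A} {T T' : Pf A} (hT : ∀ t ∈ T.carrier, ¬ t ≤ x)
    (h : T ≤ T'.insert x) : T ≤ T' := by
  intro t ht
  obtain ⟨b, hb, htb⟩ := h t ht
  rcases Pf.mem_insert.1 hb with rfl | hb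
  exacts [absurd htb (hT t ht), ⟨b, hb, htb⟩]

theorem Pf.le_insert (x : A) (T : Pf A) : T ≤ T.insert x :=
  fun t ht => ⟨t, Pf.mem_insert.2 (Or.inr ht), le_rfl⟩

theorem Pf.not_insert_le {x : A} {T' : Pf A} (hT : ∀ t ∈ T'.carrier, ¬ x ≤ t) (T : Pf A) :
    ¬ T.insert x ≤ T' := by
  intro h
  obtain ⟨b, hb, hxb⟩ := h x (Pf.mem_insert.2 (Or.inl rfl))
  exact hT b hb hxb

variable [WellQuasiOrderedLE A]

theorem one_le_gameRank_of_mem {P : Type u} {r : P → P → Prop} [IsWellFounded (Set P) (Step r)]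
    {X : Set P} {x : P} (hx : x ∈ X) : 1 ≤ gameRank r X :=
  one_le_iff_pos.2 (pos_iff_ne_zero.2 fun h => by
    rw [gameRank_eq_zero_iff] at h
    simp [h] at hx)

/-! ### Upper bound for the maximal order type -/

theorem gameRank_biUnion_lt {P ι : Type u} [Preorder P] [WellQuasiOrderedLE P] {l : Ordinal.{u}}
    (hl : IsSuccLimit l) (F : Finset ι) (X : ι → Set P)
    (h : ∀ i ∈ F, gameRank NotLE (X i) < 2 ^ l) :
    gameRank NotLE (⋃ i ∈ F, X i) < 2 ^ l := by
  classical
  induction F using Finset.induction_on with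
  | empty =>
    simpa [gameRank_empty] using opow_pos l two_pos
  | insert a F _ ih =>
    rw [Finset.set_biUnion_insert]
    refine (gameRank_union_le _ _).trans_lt ?_
    refine nadd_lt_opow_of_isSuccLimit hl (fun β _ => nadd_opow_self_le β) _ ?_ _ ?_
    · exact h a (Finset.mem_insert_self _ _)
    · exact ih fun i hi => h i (Finset.mem_insert_of_mem hi)

theorem le_of_le_of_gameRank_residual {D : Set A} {a : A}
    (h : gameRank NotLE D ≤ gameRank NotLE (residual NotLE D a) + 1) {y : A} (ha : a ∈ D)
    (hy : y ∈ D) (hay : a ≤ y) : y ≤ a := by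
  by_contra hya
  -- The elements above `a` can be played before those not above it, so they have rank at most 1; a
  -- `y` strictly above `a` would allow `y`, then `a`.
  have hsum := gameRank_add_le NotLE (residual NotLE D a) {y ∈ D | a ≤ y}
    (fun z hz w hw hzw => hw.2 (hz.2.trans hzw)) D (fun _ h => h.1) (fun _ h => h.1)
  have hZ : gameRank NotLE {y ∈ D | a ≤ y} ≤ 1 := le_of_add_le_add_left (hsum.trans h)
  have hlt := gameRank_residual_lt (NotLE (P := A)) (X := {y ∈ D | a ≤ y}) (x := y) ⟨hy, hay⟩
  have hone : 1 ≤ gameRank NotLE (residual NotLE {y ∈ D | a ≤ y} y) :=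
    one_le_gameRank_of_mem (x := a) ⟨⟨ha, le_rfl⟩, hya⟩
  exact (hone.trans_lt (hlt.trans_le hZ)).false

theorem gameRank_finSubsets_le (D : Set A) :
    gameRank NotLE (finSubsets D) ≤ 2 ^ gameRank NotLE D := by
  induction D using set_induction (NotLE (P := A)) with
  | h D ih =>
  rcases zero_or_succ_or_isSuccLimit (gameRank NotLE D) with h0 | ⟨β, hβ⟩ | hl
  · rw [h0, opow_zero]
    rw [gameRank_eq_zero_iff] at h0
    subst h0
    refine gameRank_le _ fun S hS => ?_
    have : residual NotLE (finSubsets ∅) S = ∅ := by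
      rw [Set.eq_empty_iff_forall_notMem]
      exact fun T hT => hT.2 fun s hs => absurd (hS s hs) (Set.notMem_empty _)
    rw [this, gameRank_empty]
    exact zero_lt_one
  · obtain ⟨a, ha, hle⟩ :=
      exists_le_gameRank_residual (NotLE (P := A)) (hβ ▸ Order.lt_succ β)
    have hmax : ∀ y ∈ D, a ≤ y → y ≤ a := fun y hy hay =>
      le_of_le_of_gameRank_residual (hβ ▸ Order.succ_le_succ hle) ha hy hay
    have heq : gameRank NotLE (residual NotLE D a) = β :=
      le_antisymm (Order.lt_succ_iff.1 (hβ ▸ gameRank_residual_lt _ ha)) hle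
    have iha := ih a ha
    rw [heq] at iha
    have hcover : finSubsets D ⊆ finSubsets (residual NotLE D a) ∪
        {T ∈ finSubsets D | ∃ t ∈ T.carrier, a ≤ t} := by
      intro T hT
      by_cases h : ∃ t ∈ T.carrier, a ≤ t
      · exact Or.inr ⟨hT, h⟩
      · exact Or.inl fun t ht => ⟨hT t ht, fun hat => h ⟨t, ht, hat⟩⟩
    -- Dropping the elements above `a` reflects the order: by maximality of `a`, any element above
    -- `a` in the other set dominates them.
    have hsnd : gameRank NotLE {T ∈ finSubsets D | ∃ t ∈ T.carrier, a ≤ t} ≤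
        gameRank NotLE (finSubsets (residual NotLE D a)) := by
      classical
      refine gameRank_notLE_le_of_map (fun T => ⟨T.carrier.filter fun t => ¬ a ≤ t⟩)
        (fun T hT t ht => ?_) fun T hT T' hT' hle t ht => ?_
      · rw [Finset.mem_filter] at ht
        exact ⟨hT.1 t ht.1, ht.2⟩
      · by_cases hat : a ≤ t
        · obtain ⟨t', ht', hat'⟩ := hT'.2
          exact ⟨t', ht', (hmax t (hT.1 t ht) hat).trans hat'⟩
        · obtain ⟨b, hb, htb⟩ := hle t (Finset.mem_filter.2 ⟨ht, hat⟩)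
          exact ⟨b, (Finset.mem_filter.1 hb).1, htb⟩
    rw [← hβ]
    calc gameRank NotLE (finSubsets D) ≤ _ := gameRank_mono _ hcover
      _ ≤ _ := gameRank_union_le _ _
      _ ≤ nadd (2 ^ β) (2 ^ β) := nadd_mono iha (hsnd.trans iha)
      _ ≤ 2 ^ succ β := nadd_opow_self_le β
  · refine gameRank_le _ fun S hS => ?_
    refine (gameRank_mono _ ?_).trans_lt (gameRank_biUnion_lt hl S.carrier
      (fun a => finSubsets (residual NotLE D a)) fun a ha => ?_)
    -- If `S` is not below `T`, some `a ∈ S` is below no element of `T`.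
    · rintro T ⟨hT, hST⟩
      have : ∃ a ∈ S.carrier, ∀ b ∈ T.carrier, ¬ a ≤ b := by
        by_contra! H
        exact hST H
      obtain ⟨a, ha, hab⟩ := this
      exact Set.mem_biUnion (show a ∈ (S.carrier : Set A) from ha) fun t ht => ⟨hT t ht, hab t ht⟩
    · exact (ih a (hS a ha)).trans_lt
        ((opow_lt_opow_iff_right one_lt_two).2 (gameRank_residual_lt _ (hS a ha)))

/-! ### Lower bound for the maximal order type -/

theorem opow_width_le_gameRank_finSubsets (X : Set A) :
    2 ^ gameRank Incomp X ≤ gameRank NotLE (finSubsets X) := by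
  induction X using set_induction (Incomp (P := A)) with
  | h X ih =>
  have step : ∀ x ∈ X, (2 : Ordinal.{u}) ^ (gameRank Incomp (residual Incomp X x) + 1) ≤
      gameRank NotLE (finSubsets X) := by
    intro x hx
    have hsub : residual Incomp X x ⊆ X := fun _ h => h.1
    have hZ : gameRank NotLE (finSubsets (residual Incomp X x)) ≤
        gameRank NotLE (Pf.insert x '' finSubsets (residual Incomp X x)) :=
      gameRank_notLE_le_of_map (Pf.insert x) (fun T hT => ⟨T, hT, rfl⟩)
        fun T hT T' _ hle => Pf.le_of_le_insert (fun t ht => (hT t ht).2.2)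
          ((Pf.le_insert x T).trans hle)
    have hsum := gameRank_add_le NotLE (finSubsets (residual Incomp X x))
      (Pf.insert x '' finSubsets (residual Incomp X x)) (by
        rintro _ ⟨T, _, rfl⟩ T' hT'
        exact Pf.not_insert_le (fun t ht => (hT' t ht).2.1) T)
      (finSubsets X) (finSubsets_mono hsub) (by
        rintro _ ⟨T, hT, rfl⟩
        exact Pf.insert_mem_finSubsets hx (finSubsets_mono hsub hT))
    rw [opow_add_one, ← one_add_one_eq_two, mul_add_one, mul_one,
      one_add_one_eq_two]
    exact (add_le_add (ih x hx) ((ih x hx).trans hZ)).trans hsum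
  rcases zero_or_succ_or_isSuccLimit (gameRank Incomp X) with h0 | ⟨β, hβ⟩ | hl
  · rw [h0, opow_zero]
    exact one_le_gameRank_of_mem (empty_mem_finSubsets X)
  · obtain ⟨x, hx, hle⟩ :=
      exists_le_gameRank_residual (Incomp (P := A)) (hβ ▸ Order.lt_succ β)
    rw [← hβ]
    exact (opow_le_opow_right two_pos (Order.succ_le_succ hle)).trans (step x hx)
  · rw [opow_le_of_isSuccLimit two_ne_zero hl]
    intro δ hδ
    obtain ⟨x, hx, hle⟩ := exists_le_gameRank_residual (Incomp (P := A)) hδ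
    exact (opow_le_opow_right two_pos (hle.trans (Order.le_succ _))).trans (step x hx)

/-! ### Lower bound for the width -/

/-- A set of limit width has elements `y` for which both the elements incomparable to `y` and
the elements not below `y` form a wide set. -/
theorem exists_wide_residual {Y : Set A} {l δ : Ordinal.{u}} (hl : IsSuccLimit l)
    (hY : l ≤ gameRank Incomp Y) (hδ : δ < l) :
    ∃ y ∈ Y, δ ≤ gameRank Incomp (residual Incomp Y y) ∧
      l ≤ gameRank Incomp {z ∈ Y | ¬ z ≤ y} := by
  by_contra! H
  -- If every `y` with residual width at least `δ` fails, let `ε < l` be the width of the elements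
  -- not below such a `y`. Any `z ≥ y` has residual width at most `ε`, so discarding these keeps the
  -- residual widths cofinal in `l`, and the descent never ends.
  have key : ∀ X ⊆ Y, ¬ ∀ b < l, ∃ y ∈ X, b ≤ gameRank Incomp (residual Incomp Y y) := by
    intro X
    induction X using set_induction (NotLE (P := A)) with
    | h X ih =>
    intro hXY hX
    obtain ⟨y, hy, hδy⟩ := hX δ hδ
    refine ih y hy (fun z hz => hXY hz.1) fun b hb => ?_
    have hε := H y (hXY hy) hδy
    obtain ⟨z, hz, hle⟩ := hX (max b (succ _)) (max_lt hb (hl.succ_lt hε))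
    refine ⟨z, ⟨hz, fun hyz => ?_⟩, (le_max_left _ _).trans hle⟩
    have hsub : residual Incomp Y z ⊆ {z ∈ Y | ¬ z ≤ y} :=
      fun w hw => ⟨hw.1, fun hwy => hw.2.2 (hwy.trans hyz)⟩
    exact ((Order.succ_le_iff.1 ((le_max_right _ _).trans hle)).trans_le
      (gameRank_mono _ hsub)).false
  exact key Y subset_rfl fun b hb => exists_le_gameRank_residual _ (hb.trans_le hY)

theorem gameRank_incomp_le_finSubsets (Y : Set A) :
    gameRank Incomp Y ≤ gameRank Incomp (finSubsets Y) := by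
  refine gameRank_incomp_le_of_map (fun y => ⟨{y}⟩) (fun y hy t ht => ?_) fun y _ y' _ h => ?_
  · rw [Finset.mem_singleton.1 ht]
    exact hy
  · obtain ⟨b, hb, hyb⟩ := h y (Finset.mem_singleton_self y)
    rwa [Finset.mem_singleton.1 hb] at hyb

theorem gameRank_incomp_prod_one_le (Y : Set A) :
    gameRank Incomp (finSubsets Y ×ˢ Set.Iio (1 : ℕ)) ≤ gameRank Incomp (finSubsets Y) := by
  refine gameRank_incomp_le_of_map Prod.fst (fun p hp => hp.1) fun p hp q hq h => ⟨h, ?_⟩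
  have hp2 : p.2 < 1 := hp.2
  omega

/-- The chain of length `2 * k` folds into one of length `k`: the parity of the index decides
whether `x` is added. -/
theorem opow_succ_mul_le_gameRank {β : Ordinal.{u}} {Y : Set A} {x : A} (hx : x ∈ Y) (k : ℕ)
    (h : 2 ^ β * (2 * k : ℕ) ≤
      gameRank Incomp (finSubsets (residual Incomp Y x) ×ˢ Set.Iio (2 * k))) :
    2 ^ succ β * k ≤ gameRank Incomp (finSubsets Y ×ˢ Set.Iio k) := by
  have e : (2 : Ordinal.{u}) ^ succ β * k = 2 ^ β * (2 * k : ℕ) := by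
    rw [opow_succ, mul_assoc]
    push_cast
    rfl
  rw [e]
  refine h.trans ?_
  refine gameRank_incomp_le_of_map
    (fun p => (if p.2 % 2 = 1 then p.1.insert x else p.1, p.2 / 2)) ?_ ?_
  · rintro ⟨T, i⟩ ⟨hT, hi⟩
    have hi : i < 2 * k := hi
    have hT : T ∈ finSubsets Y := finSubsets_mono (fun _ h => h.1) hT
    refine ⟨?_, show i / 2 < k by omega⟩
    dsimp only
    split_ifs
    exacts [Pf.insert_mem_finSubsets hx hT, hT]
  · rintro ⟨T, i⟩ ⟨hT, -⟩ ⟨T', i'⟩ ⟨hT', -⟩ ⟨h1, h2⟩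
    dsimp only at h1 h2 hT hT'
    have hTx : ∀ t ∈ T.carrier, ¬ t ≤ x := fun t ht => (hT t ht).2.2
    split_ifs at h1 with hi hi' hi'
    · exact ⟨Pf.le_of_le_insert hTx ((Pf.le_insert x T).trans h1), show i ≤ i' by omega⟩
    · exact absurd h1 (Pf.not_insert_le (fun t ht => (hT' t ht).2.1) T)
    · exact ⟨Pf.le_of_le_insert hTx h1, show i ≤ i' by omega⟩
    · exact ⟨h1, show i ≤ i' by omega⟩

/-- Sets avoiding `y` at the top level `k` are played first, then sets containing `y` at levels
below `k`: the level blocks one comparison, `y` the other. -/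
theorem gameRank_prod_succ_ge {Y : Set A} {y : A} (hy : y ∈ Y) (k : ℕ) :
    gameRank Incomp (finSubsets {z ∈ Y | ¬ z ≤ y} ×ˢ Set.Iio k) +
        gameRank Incomp (finSubsets (residual Incomp Y y)) ≤
      gameRank Incomp (finSubsets Y ×ˢ Set.Iio (k + 1)) := by
  have hW : gameRank Incomp (finSubsets {z ∈ Y | ¬ z ≤ y} ×ˢ Set.Iio k) ≤
      gameRank Incomp ((fun p : Pf A × ℕ => (p.1.insert y, p.2)) ''
        (finSubsets {z ∈ Y | ¬ z ≤ y} ×ˢ Set.Iio k)) := by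
    refine gameRank_incomp_le_of_map _ (fun p hp => Set.mem_image_of_mem _ hp) ?_
    rintro p ⟨hp, -⟩ q - ⟨h1, h2⟩
    exact ⟨Pf.le_of_le_insert (fun t ht => (hp t ht).2) ((Pf.le_insert y p.1).trans h1), h2⟩
  have hZ : gameRank Incomp (finSubsets (residual Incomp Y y)) ≤
      gameRank Incomp (finSubsets (residual Incomp Y y) ×ˢ ({k} : Set ℕ)) :=
    gameRank_incomp_le_of_map (fun T => (T, k)) (fun T hT => ⟨hT, rfl⟩) fun T _ T' _ h => h.1
  refine (add_le_add hW hZ).trans (gameRank_add_le _ _ _ ?_ _ ?_ ?_)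
  · rintro ⟨T, _⟩ ⟨hT, rfl⟩ _ ⟨⟨T', j⟩, ⟨-, hj⟩, rfl⟩
    refine ⟨fun h => ?_, fun h => ?_⟩
    · exact (show j < _ from hj).not_ge h.2
    · exact Pf.not_insert_le (fun t ht => (hT t ht).2.1) T' h.1
  · rintro _ ⟨⟨T, j⟩, ⟨hT, hj⟩, rfl⟩
    exact ⟨Pf.insert_mem_finSubsets hy (finSubsets_mono (fun _ h => h.1) hT),
      Nat.lt_succ_of_lt hj⟩
  · rintro ⟨T, _⟩ ⟨hT, rfl⟩
    exact ⟨finSubsets_mono (fun _ h => h.1) hT, Nat.lt_succ_self _⟩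

/-- The bound fails for finite `α`: over `∅` with `k = 2` only a chain remains. Hence the induction
begins at the limit `ω`. -/
theorem opow_mul_le_gameRank_prod (α : Ordinal.{u}) (hα : ω ≤ α) (Y : Set A)
    (hY : α ≤ gameRank Incomp Y) (k : ℕ) :
    2 ^ α * k ≤ gameRank Incomp (finSubsets Y ×ˢ Set.Iio k) := by
  induction α using WellFoundedLT.induction generalizing Y k with
  | ind α ih =>
  rcases zero_or_succ_or_isSuccLimit α with rfl | ⟨β, rfl⟩ | hl
  · exact absurd hα (not_le.2 omega0_pos)
  · have hβ : ω ≤ β := by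
      by_contra! h
      exact (isSuccLimit_omega0.succ_lt h).not_ge hα
    obtain ⟨x, hx, hle⟩ := exists_le_gameRank_residual _ (Order.succ_le_iff.1 hY)
    exact opow_succ_mul_le_gameRank hx k (ih β (Order.lt_succ β) hβ _ hle _)
  · induction k generalizing Y with
    | zero => simp
    | succ k ihk =>
      rw [Nat.cast_succ, mul_add_one,
        add_le_iff_of_isSuccLimit (isSuccLimit_opow one_lt_two hl)]
      intro ξ hξ
      obtain ⟨c, hc, hξc⟩ := (lt_opow_of_isSuccLimit two_ne_zero hl).1 hξ
      have : ∃ δ < α, ∀ Z : Set A, δ ≤ gameRank Incomp Z →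
          ξ ≤ gameRank Incomp (finSubsets Z) := by
        obtain hcω | hωc := lt_or_ge c ω
        · obtain ⟨n, rfl⟩ := lt_omega0.1 hcω
          -- Below `ω` the induction hypothesis is unavailable; singletons already give width `2 ^
          -- n`, still below the limit `α`.
          refine ⟨(2 ^ n : ℕ), natCast_lt_of_isSuccLimit hl _, fun Z hZ => ?_⟩
          refine hξc.le.trans (le_trans ?_ (hZ.trans (gameRank_incomp_le_finSubsets Z)))
          simp
        · refine ⟨c, hc, fun Z hZ => hξc.le.trans ?_⟩
          have := (ih c hc hωc Z hZ 1).trans (gameRank_incomp_prod_one_le Z)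
          simpa using this
      obtain ⟨δ, hδ, hδZ⟩ := this
      obtain ⟨y, hy, h1, h2⟩ := exists_wide_residual hl hY hδ
      exact (add_le_add (ihk _ h2) (hδZ _ h1)).trans (gameRank_prod_succ_ge hy k)

theorem maxOrderType_Pf_le : maxOrderType (Pf A) ≤ 2 ^ maxOrderType A := by
  rw [maxOrderType_eq_gameRank, maxOrderType_eq_gameRank, ← finSubsets_univ]
  exact gameRank_finSubsets_le _

theorem opow_width_le_maxOrderType_Pf : 2 ^ width A ≤ maxOrderType (Pf A) := by
  rw [maxOrderType_eq_gameRank, width_eq_gameRank, ← finSubsets_univ]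
  exact opow_width_le_gameRank_finSubsets _

theorem width_le_maxOrderType : width A ≤ maxOrderType A := by
  rw [maxOrderType_eq_gameRank, width_eq_gameRank]
  exact gameRank_incomp_le_notLE _

theorem one_le_width_Pf : 1 ≤ width (Pf A) := by
  rw [width_eq_gameRank]
  exact one_le_gameRank_of_mem (Set.mem_univ (⟨∅⟩ : Pf A))

theorem opow_width_le_width_Pf (h : ω ≤ width A) : 2 ^ width A ≤ width (Pf A) := by
  rw [width_eq_gameRank] at h ⊢
  rw [width_eq_gameRank, ← finSubsets_univ]
  simpa using (opow_mul_le_gameRank_prod _ h Set.univ le_rfl 1).trans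
    (gameRank_incomp_prod_one_le _)

end Powerset

end Wqo

theorem mainTheorem7 (A : Type u) [Preorder A] [WellQuasiOrderedLE A]
    (h : Wqo.width A = Wqo.maxOrderType A) :
    Wqo.maxOrderType (Wqo.Pf A) = (2 : Ordinal.{u}) ^ Wqo.maxOrderType A ∧
      (Wqo.maxOrderType A = 0 ∨ Ordinal.omega0.{u} ≤ Wqo.maxOrderType A →
        Wqo.width (Wqo.Pf A) = (2 : Ordinal.{u}) ^ Wqo.maxOrderType A) := by
  refine ⟨le_antisymm Wqo.maxOrderType_Pf_le (h ▸ Wqo.opow_width_le_maxOrderType_Pf),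
    fun hA => le_antisymm (Wqo.width_le_maxOrderType.trans Wqo.maxOrderType_Pf_le) ?_⟩
  rcases hA with h0 | hω
  · rw [h0, Ordinal.opow_zero]
    exact Wqo.one_le_width_Pf
  · rw [← h] at hω ⊢
    exact Wqo.opow_width_le_width_Pf hω
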